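/- Let $(X_n)_{n\in\mathbb Z}$ be a zero-mean, real-valued, wide-sense stationary sequence in $L_2(\mathbb P)$, where $\mathbb P$ is a probability measure. Let $R_k=\mathbb E[X_{n+k}X_n]$ be its covariance sequence and $S_X(\lambda)=\sum_{k\in\mathbb Z}R_k e^{-2\pi i\lambda k}$, $\lambda\in(-\tfrac12,\tfrac12]$, its spectral density. For $n\in\mathbb Z$ let $H_n$ be the closed linear span of $X_n,X_{n-1},\dots$ in $L_2(\mathbb P)$, and for $p\ge 1$ let $H_n^p$ be the linear span of $X_n,\dots,X_{n-p+1}$. Assume that the sequence is regular, i.e. $\bigcap_n H_n=\{0\}$. Let $\overline X_{n,p}$ and $\overline X_n$ be the orthogonal projections of $X_n$ onto $H_{n-1}^p$ and $H_{n-1}$ respectively (the linear predictors of order $p$ and of infinite order with least mean square error), let $\nu_n=X_n-\overline X_n$ be the innovations, and let $(a_k)_{k\ge0}$ be the coefficients of the Wold decomposition $X_n=\sum_{k\ge0}a_k\nu_{n-k}$, that is, $a_k=\mathbb E[X_n\nu_{n-k}]/\mathbb E[\nu_{n-k}^2]$. Assume that $S_X(\lambda)>0$ for all $\lambda\in(-\tfrac12,\tfrac12]$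 and that $\sum_{k\ge0}|a_k|<\infty$. Then the sequences $(\overline X_{n,p})_n$ (for each $p$) and $(\overline X_n)_n$ are zero-mean and wide-sense stationary, their covariance sequences $(\overline R_{k,p})_k$ and $(\overline R_k)_k$ are absolutely summable, their spectral densities $S_{\overline X_p}(\lambda)=\sum_{k\in\mathbb Z}\overline R_{k,p}e^{-2\pi i\lambda k}$ and $S_{\overline X}(\lambda)=\sum_{k\in\mathbb Z}\overline R_{k}e^{-2\pi i\lambda k}$ lie in $L_2((-\tfrac12,\tfrac12])$, and, as $p\to\infty$, $$\sum_{k\in\mathbb Z}|\overline R_{k,p}-\overline R_k|\to0\qquad\text{and}\qquad \int_{-1/2}^{1/2}\bigl|S_{\overline X_p}(\lambda)-S_{\overline X}(\lambda)\bigr|^2\,d\lambda\to0 .$$ -/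

import Mathlib

open MeasureTheory Filter Topology
open scoped ComplexOrder ENNReal

noncomputable section

namespace WSS

variable {Ω : Type*} [MeasurableSpace Ω] {P : Measure Ω}

/-- A zero-mean, real-valued, wide-sense stationary sequence of elements of `L²(P)`:
all means vanish and `E[X (n + k) * X n]` does not depend on `n`. -/
structure IsWSS (X : ℤ → Lp ℝ 2 P) : Prop where
  mean_zero : ∀ n, ∫ ω, X n ω ∂P = 0
  stationary : ∀ n m k, ∫ ω, X (n + k) ω * X n ω ∂P = ∫ ω, X (m + k) ω * X m ω ∂P

/-- The covariance sequence `R k = E[X (n + k) * X n]` of a wide-sense stationary sequence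
(evaluated at `n = 0`; by stationarity the choice of `n` is immaterial). -/
def cov (X : ℤ → Lp ℝ 2 P) (k : ℤ) : ℝ :=
  ∫ ω, X k ω * X 0 ω ∂P

/-- The spectral density `S(t) = ∑_{k ∈ ℤ} R k * exp(-2 π i t k)`. -/
def spectralDensity (X : ℤ → Lp ℝ 2 P) (t : ℝ) : ℂ :=
  ∑' k : ℤ, (cov X k : ℂ) * Complex.exp (-2 * Real.pi * Complex.I * t * k)

/-- The closed linear span of the `p` most recent values `X n, X (n - 1), …, X (n - p + 1)`.
For `p = ⊤` it is the closed linear span of the whole past `X n, X (n - 1), …`. -/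
def past (X : ℤ → Lp ℝ 2 P) (p : ℕ∞) (n : ℤ) : Submodule ℝ (Lp ℝ 2 P) :=
  (Submodule.span ℝ {Y | ∃ j : ℕ, (j : ℕ∞) < p ∧ Y = X (n - j)}).topologicalClosure

/-- A sequence is regular (purely non-deterministic) if its remote past is trivial. -/
def IsRegular (X : ℤ → Lp ℝ 2 P) : Prop :=
  (⨅ n : ℤ, past X ⊤ n) = ⊥

/-- The space `past X p n` is complete, being closed in `L²(P)`. -/
instance completeSpace_past (X : ℤ → Lp ℝ 2 P) (p : ℕ∞) (n : ℤ) : CompleteSpace (past X p n) := by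
  unfold past; infer_instance

/-- The linear predictor of order `p` with least mean square error: the orthogonal projection of
`X n` onto the closed span of `X (n - 1), …, X (n - p)` (of the whole past, if `p = ⊤`). -/
def predictor (X : ℤ → Lp ℝ 2 P) (p : ℕ∞) (n : ℤ) : Lp ℝ 2 P :=
  (past X p (n - 1)).starProjection (X n)

/-- The innovation process `ν n = X n - predictor of X n from the whole past`. -/
def innovation (X : ℤ → Lp ℝ 2 P) (n : ℤ) : Lp ℝ 2 P :=
  X n - predictor X ⊤ n

/-- The coefficients `a k = E[X 0 * ν (-k)] / E[ν (-k) ^ 2]` of the Wold decomposition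
`X n = ∑_{k ≥ 0} a k • ν (n - k)`. The variance of the innovations need not be `1`. -/
def woldCoeff (X : ℤ → Lp ℝ 2 P) (k : ℕ) : ℝ :=
  (∫ ω, X 0 ω * innovation X (-k) ω ∂P) / ∫ ω, innovation X (-k) ω ^ 2 ∂P

/-- The innovations are pairwise orthogonal. -/
theorem inner_innovation (X : ℤ → Lp ℝ 2 P) {m n : ℤ} (h : m ≠ n) :
    inner ℝ (innovation X m) (innovation X n) = 0 := by
  wlog hmn : m < n generalizing m n
  · rw [real_inner_comm]; exact this h.symm (by omega)
  have hmono : past X ⊤ (m - 1) ≤ past X ⊤ (n - 1) := by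
    apply Submodule.topologicalClosure_mono
    apply Submodule.span_mono
    rintro Y ⟨j, hj, rfl⟩
    refine ⟨j + (n - m).toNat, ENat.natCast_lt_top _, ?_⟩
    congr 1; push_cast; omega
  have hX : X m ∈ past X ⊤ (n - 1) := by
    apply Submodule.le_topologicalClosure
    apply Submodule.subset_span
    refine ⟨(n - 1 - m).toNat, ENat.natCast_lt_top _, ?_⟩
    congr 1; omega
  have hm : innovation X m ∈ past X ⊤ (n - 1) :=
    Submodule.sub_mem _ hX (hmono (Submodule.starProjection_apply_mem _ _))
  exact Submodule.inner_right_of_mem_orthogonal hm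
    (Submodule.sub_starProjection_mem_orthogonal (X n))

/-- If `X 0 = ∑ a k • ν (-k)` in `L²(P)`, with non-degenerate innovations, then `a` is the
sequence `woldCoeff X`. -/
theorem eq_woldCoeff (X : ℤ → Lp ℝ 2 P) (a : ℕ → ℝ)
    (hν : ∀ k : ℕ, innovation X (-k) ≠ 0)
    (ha : HasSum (fun k : ℕ => a k • innovation X (-k)) (X 0)) : a = woldCoeff X := by
  funext k
  have h1 : HasSum (fun j : ℕ => inner ℝ (innovation X (-k)) (a j • innovation X (-j)))
      (inner ℝ (innovation X (-k)) (X 0)) :=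
    ha.mapL (innerSL ℝ (innovation X (-k)))
  have h2 : HasSum (fun j : ℕ => inner ℝ (innovation X (-k)) (a j • innovation X (-j)))
      (inner ℝ (innovation X (-k)) (a k • innovation X (-k))) := by
    apply hasSum_single
    intro j hj
    rw [real_inner_smul_right, inner_innovation X (by omega), mul_zero]
  have h3 := h1.unique h2
  have hne : inner ℝ (innovation X (-k)) (innovation X (-k)) ≠ 0 :=
    inner_self_ne_zero.2 (hν k)
  rw [real_inner_smul_right] at h3
  have e1 : inner ℝ (innovation X (-k)) (X 0) = ∫ ω, X 0 ω * innovation X (-k) ω ∂P := by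
    simp [L2.inner_def]
  have e2 : inner ℝ (innovation X (-k)) (innovation X (-k)) =
      ∫ ω, innovation X (-k) ω ^ 2 ∂P := by
    rw [L2.inner_def]; simp [pow_two]
  rw [woldCoeff, ← e1, ← e2, h3, mul_div_cancel_right₀ _ hne]

end WSS

end

/-! Everything takes place in the convolution algebra `ℓ¹(ℤ)`. Regularity gives the Wold expansion
of `X 0`, so the covariance is `R = s • (a * reflect a)`, where `s` is the innovation variance. The
function `A z = ∑ a k * z ^ k` has no zero in the closed unit disc: on the circle, `s * |A| ^ 2` is
the positive spectral density; inside, a zero would yield a series of innovations orthogonal to the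
whole past of `X` but not to the innovation at time `0` (`woldSeq_ne_zero_of_norm_lt_one`). Wiener's
lemma, in the form `exists_causal_inverse`, then provides a causal `b` in `ℓ¹` with `a * b = δ`.

If `c` denotes the predictor filter of order `p`, the error filter `g = δ - c` satisfies `R * g = 0`
on the indices `1, …, p`, whereas `R * b = s • reflect a` vanishes at all positive indices. Baxter's
inequality (`norm_sub_le_of_normal_equations`) turns this into a bound of `‖g - b‖` by a multiple of
the tail of `b` beyond `p`. Hence `c` tends to `δ - b` in `ℓ¹` (`tendsto_filterSeq`).

The covariance of the predictor is `c * reflect c * R`, continuous in `c`, so it converges in `ℓ¹`.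
The limit is the covariance for infinite order, since the predictors themselves converge in `L²(P)`.
Spectral densities follow because a Fourier series is bounded by the `ℓ¹` norm of its coefficients.
-/

noncomputable section

/-- The complex Banach space `ℓ¹(ℤ)`. -/
abbrev EllOne : Type := lp (fun _ : ℤ => ℂ) 1

/-! ### Convolution on `ℓ¹(ℤ)` -/

namespace EllOne

variable {F : Type*} [NormedAddCommGroup F] [NormedSpace ℂ F]

/-- The unit mass at `k`. -/
def unit (k : ℤ) : EllOne := lp.single 1 k (1 : ℂ)

theorem norm_unit (k : ℤ) : ‖unit k‖ = 1 := by
  simp [unit, lp.norm_single]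

theorem unit_apply (k j : ℤ) : unit k j = if j = k then 1 else 0 := by
  simp [unit, lp.single_apply, Pi.single_apply]

theorem hasSum_norm (x : EllOne) : HasSum (fun k => ‖x k‖) ‖x‖ := by
  simpa using lp.hasSum_norm (p := 1) (by simp) x

theorem hasSum_unit (x : EllOne) : HasSum (fun k => x k • unit k) x := by
  have h := lp.hasSum_single (p := 1) (by simp) x
  convert h using 2 with k
  rw [unit, ← lp.single_smul]
  simp

/-- A continuous linear map on `ℓ¹(ℤ)` is determined by its values on the unit masses. -/
theorem ext_unit {f g : EllOne →L[ℂ] F} (h : ∀ k, f (unit k) = g (unit k)) : f = g := by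
  ext x
  have hf := (hasSum_unit x).mapL f
  have hg := (hasSum_unit x).mapL g
  simp only [map_smul, h] at hf hg
  exact hf.unique hg

/-- A summable sequence as an element of `ℓ¹(ℤ)`. -/
def ofSummable (f : ℤ → ℂ) (hf : Summable fun k => ‖f k‖) : EllOne :=
  ⟨f, memℓp_gen (by simpa using hf)⟩

@[simp] theorem ofSummable_apply (f : ℤ → ℂ) (hf : Summable fun k => ‖f k‖) (k : ℤ) :
    ofSummable f hf k = f k := rfl

variable [CompleteSpace F]

theorem summable_smul (u : ℤ → F) {M : ℝ} (hu : ∀ k, ‖u k‖ ≤ M) (x : EllOne) :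
    Summable fun k => x k • u k := by
  refine Summable.of_norm_bounded ((hasSum_norm x).summable.mul_right M) fun k => ?_
  rw [norm_smul]
  exact mul_le_mul_of_nonneg_left (hu k) (norm_nonneg _)

/-- The continuous linear extension to `ℓ¹(ℤ)` of a bounded family of values on the unit masses. -/
def lift (u : ℤ → F) (M : ℝ) (hu : ∀ k, ‖u k‖ ≤ M) : EllOne →L[ℂ] F :=
  LinearMap.mkContinuous
    { toFun := fun x => ∑' k, x k • u k
      map_add' := fun x y => by
        rw [← (summable_smul u hu x).tsum_add (summable_smul u hu y)]
        simp [add_smul]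
      map_smul' := fun c x => by
        rw [RingHom.id_apply, ← (summable_smul u hu x).tsum_const_smul]
        simp [mul_smul] }
    M fun x => by
      rw [mul_comm]
      refine tsum_of_norm_bounded ((hasSum_norm x).mul_right M) fun k => ?_
      rw [norm_smul]
      exact mul_le_mul_of_nonneg_left (hu k) (norm_nonneg _)

theorem lift_apply (u : ℤ → F) (M : ℝ) (hu : ∀ k, ‖u k‖ ≤ M) (x : EllOne) :
    lift u M hu x = ∑' k, x k • u k := rfl

theorem lift_hasSum (u : ℤ → F) (M : ℝ) (hu : ∀ k, ‖u k‖ ≤ M) (x : EllOne) :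
    HasSum (fun k => x k • u k) (lift u M hu x) :=
  (summable_smul u hu x).hasSum

@[simp] theorem lift_unit (u : ℤ → F) (M : ℝ) (hu : ∀ k, ‖u k‖ ≤ M) (k : ℤ) :
    lift u M hu (unit k) = u k := by
  rw [lift_apply, tsum_eq_single k]
  · simp [unit_apply]
  · intro j hj
    simp [unit_apply, hj]

theorem norm_lift_apply_le (u : ℤ → F) (M : ℝ) (hu : ∀ k, ‖u k‖ ≤ M) (x : EllOne) :
    ‖lift u M hu x‖ ≤ M * ‖x‖ := by
  refine ContinuousLinearMap.le_of_opNorm_le _ ?_ x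
  exact LinearMap.mkContinuous_norm_le _ ((norm_nonneg _).trans (hu 0)) _

/-- Translation by `n` on `ℓ¹(ℤ)`. -/
def shift (n : ℤ) : EllOne →L[ℂ] EllOne :=
  lift (fun k => unit (k + n)) 1 fun _ => (norm_unit _).le

@[simp] theorem shift_unit (n k : ℤ) : shift n (unit k) = unit (k + n) := by simp [shift]

theorem norm_shift_le (n : ℤ) : ‖shift n‖ ≤ 1 :=
  ContinuousLinearMap.opNorm_le_bound _ zero_le_one (norm_lift_apply_le _ _ _)

theorem shift_apply (n : ℤ) (x : EllOne) (j : ℤ) : shift n x j = x (j - n) := by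
  have : (lp.evalCLM ℂ (fun _ : ℤ => ℂ) 1 j).comp (shift n) =
      lp.evalCLM ℂ (fun _ : ℤ => ℂ) 1 (j - n) := by
    refine ext_unit fun k => ?_
    simp only [ContinuousLinearMap.comp_apply, shift_unit]
    change unit (k + n) j = unit k (j - n)
    simp only [unit_apply, sub_eq_iff_eq_add]
  exact DFunLike.congr_fun this x

/-- Convolution on `ℓ¹(ℤ)`. -/
def conv : EllOne →L[ℂ] EllOne →L[ℂ] EllOne := lift shift 1 norm_shift_le

@[simp] theorem conv_unit (j : ℤ) : conv (unit j) = shift j := by simp [conv]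

theorem norm_conv_le (x y : EllOne) : ‖conv x y‖ ≤ ‖x‖ * ‖y‖ := by
  refine ContinuousLinearMap.le_of_opNorm_le _ ?_ y
  simpa [conv] using norm_lift_apply_le shift 1 norm_shift_le x

theorem hasSum_conv (x y : EllOne) (j : ℤ) :
    HasSum (fun k => x k * y (j - k)) (conv x y j) := by
  have h := lift_hasSum shift 1 norm_shift_le x
  have h1 := (h.mapL (ContinuousLinearMap.apply ℂ EllOne y)).mapL
    (lp.evalCLM ℂ (fun _ : ℤ => ℂ) 1 j)
  refine (congrArg (HasSum · _) (funext fun k => ?_)).mpr h1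
  change _ = (x k • shift k y) j
  rw [lp.coeFn_smul, Pi.smul_apply, shift_apply, smul_eq_mul]

/-- Both sides are continuous and bilinear, so it suffices to compare them on unit masses, where
convolution adds indices. The other algebraic identities are obtained in the same way. -/
theorem conv_comm (x y : EllOne) : conv x y = conv y x := by
  have : conv = conv.flip := by
    refine ext_unit fun j => ext_unit fun k => ?_
    simp [add_comm]
  exact DFunLike.congr_fun (DFunLike.congr_fun this x) y

theorem conv_shift (n : ℤ) (x y : EllOne) : conv (shift n x) y = shift n (conv x y) := by
  have : conv.comp (shift n) = (ContinuousLinearMap.compL ℂ EllOne EllOne EllOne (shift n)).comp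
      conv := by
    refine ext_unit fun j => ext_unit fun k => ?_
    simp [add_assoc]
  exact DFunLike.congr_fun (DFunLike.congr_fun this x) y

theorem conv_assoc (x y z : EllOne) : conv (conv x y) z = conv x (conv y z) := by
  have : (conv.flip z).comp (conv.flip y) = conv.flip (conv y z) := by
    refine ext_unit fun j => ?_
    simp [conv_shift]
  exact DFunLike.congr_fun this x

theorem unit_conv (x : EllOne) : conv (unit 0) x = x := by
  have : shift 0 = ContinuousLinearMap.id ℂ EllOne := ext_unit fun k => by simp
  simp [this]

theorem conv_left_comm (x y z : EllOne) : conv x (conv y z) = conv y (conv x z) := by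
  rw [← conv_assoc, conv_comm x y, conv_assoc]

/-! ### Truncation, reflection and supports -/

/-- Restriction of a sequence to the indices `k ≥ n`. -/
def trunc (n : ℤ) : EllOne →L[ℂ] EllOne :=
  lift (fun k => if n ≤ k then unit k else 0) 1 fun k => by
    split_ifs <;> simp [norm_unit]

theorem trunc_unit (n k : ℤ) : trunc n (unit k) = if n ≤ k then unit k else 0 := by simp [trunc]

theorem norm_trunc_le (n : ℤ) (x : EllOne) : ‖trunc n x‖ ≤ ‖x‖ :=
  (norm_lift_apply_le _ 1 _ x).trans_eq (one_mul _)

theorem trunc_apply (n : ℤ) (x : EllOne) (j : ℤ) : trunc n x j = if n ≤ j then x j else 0 := by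
  have : (lp.evalCLM ℂ (fun _ : ℤ => ℂ) 1 j).comp (trunc n) =
      if n ≤ j then lp.evalCLM ℂ (fun _ : ℤ => ℂ) 1 j else 0 := by
    refine ext_unit fun k => ?_
    simp only [ContinuousLinearMap.comp_apply, trunc_unit]
    change (if n ≤ k then unit k else 0 : EllOne) j = _
    split_ifs with h1 h2 h2
    · rfl
    · simp [unit_apply]; omega
    · change _ = unit k j
      simp [unit_apply]; omega
    · simp
  have h := DFunLike.congr_fun this x
  change trunc n x j = _ at h
  rw [h]
  split_ifs <;> rfl

theorem trunc_eq_self_iff {n : ℤ} {x : EllOne} : trunc n x = x ↔ ∀ j < n, x j = 0 := by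
  constructor
  · intro h j hj
    rw [← h, trunc_apply, if_neg (by omega)]
  · intro h
    ext j
    rw [trunc_apply]
    split_ifs with hj
    · rfl
    · exact (h j (by omega)).symm

theorem trunc_eq_zero_iff {n : ℤ} {x : EllOne} : trunc n x = 0 ↔ ∀ j, n ≤ j → x j = 0 := by
  constructor
  · intro h j hj
    have := trunc_apply n x j
    rw [h, if_pos hj] at this
    exact this.symm
  · intro h
    ext j
    rw [trunc_apply]
    split_ifs with hj
    · exact h j hj
    · rfl

theorem trunc_conv {m n : ℤ} {x y : EllOne} (hx : trunc m x = x) (hy : trunc n y = y) :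
    trunc (m + n) (conv x y) = conv x y := by
  rw [trunc_eq_self_iff] at *
  intro j hj
  refine (hasSum_conv x y j).unique ?_
  convert hasSum_zero with k
  rcases lt_or_ge k m with h | h
  · rw [hx k h, zero_mul]
  · rw [hy (j - k) (by omega), mul_zero]

/-- Reflection `k ↦ -k` of a sequence. -/
def reflect : EllOne →L[ℂ] EllOne := lift (fun k => unit (-k)) 1 fun _ => (norm_unit _).le

@[simp] theorem reflect_unit (k : ℤ) : reflect (unit k) = unit (-k) := by simp [reflect]

theorem norm_reflect_le (x : EllOne) : ‖reflect x‖ ≤ ‖x‖ :=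
  (norm_lift_apply_le _ 1 _ x).trans_eq (one_mul _)

theorem reflect_apply (x : EllOne) (j : ℤ) : reflect x j = x (-j) := by
  have : (lp.evalCLM ℂ (fun _ : ℤ => ℂ) 1 j).comp reflect =
      lp.evalCLM ℂ (fun _ : ℤ => ℂ) 1 (-j) := by
    refine ext_unit fun k => ?_
    simp only [ContinuousLinearMap.comp_apply, reflect_unit]
    change unit (-k) j = unit k (-j)
    simp only [unit_apply, neg_eq_iff_eq_neg]
  exact DFunLike.congr_fun this x

theorem reflect_conv (x y : EllOne) : reflect (conv x y) = conv (reflect x) (reflect y) := by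
  have : (ContinuousLinearMap.compL ℂ EllOne EllOne EllOne reflect).comp conv =
      ((ContinuousLinearMap.compL ℂ EllOne EllOne EllOne).flip reflect).comp
        (conv.comp reflect) := by
    refine ext_unit fun j => ext_unit fun k => ?_
    simp [add_comm]
  exact DFunLike.congr_fun (DFunLike.congr_fun this x) y

/-- An anticausal factor moves mass only to the left, so it cannot create mass at or beyond `n`. -/
theorem trunc_reflect_conv {n : ℤ} {x y : EllOne} (hx : trunc 0 x = x) (hy : trunc n y = 0) :
    trunc n (conv (reflect x) y) = 0 := by
  rw [trunc_eq_self_iff] at hx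
  rw [trunc_eq_zero_iff] at *
  intro j hj
  refine (hasSum_conv _ y j).unique ?_
  convert hasSum_zero with k
  rw [reflect_apply]
  rcases lt_or_ge 0 k with h | h
  · rw [hx (-k) (by omega), zero_mul]
  · rw [hy (j - k) (by omega), mul_zero]

theorem trunc_trunc_of_le {m n : ℤ} (h : m ≤ n) (x : EllOne) : trunc m (trunc n x) = trunc n x := by
  rw [trunc_eq_self_iff]
  intro j hj
  rw [trunc_apply, if_neg (by omega)]

theorem trunc_sub_trunc (n : ℤ) (x : EllOne) : trunc n (x - trunc n x) = 0 := by
  rw [map_sub, trunc_trunc_of_le le_rfl, sub_self]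

theorem tendsto_norm_trunc (x : EllOne) :
    Tendsto (fun p : ℕ => ‖trunc (p + 1) x‖) atTop (𝓝 0) := by
  have hlim : Tendsto (fun p : ℕ => ∑' k, ‖trunc (p + 1) x k‖) atTop (𝓝 (∑' _ : ℤ, (0 : ℝ))) := by
    refine tendsto_tsum_of_dominated_convergence (hasSum_norm x).summable (fun k => ?_)
      (Eventually.of_forall fun p k => ?_)
    · refine tendsto_const_nhds.congr' ?_
      filter_upwards [eventually_ge_atTop k.toNat] with p hp
      rw [trunc_apply, if_neg (by omega), norm_zero]
    · rw [trunc_apply]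
      split_ifs <;> simp
  simpa only [(hasSum_norm _).tsum_eq, tsum_zero] using hlim

/-! ### Baxter's inequality -/

/-- Baxter's inequality: if `g` is supported on `[0, p]`, agrees with the causal inverse `b` of the
causal sequence `a` at the index `0`, and solves the normal equations of order `p` for
`a * reflect a`, then `g` is close to `b` as soon as the tail of `b` beyond `p` is small. -/
theorem norm_sub_le_of_normal_equations {a b g : EllOne} {p : ℤ}
    (ha : trunc 0 a = a) (hb : trunc 0 b = b) (hab : conv a b = unit 0)
    (hgb : trunc 1 (g - b) = g - b) (hg : trunc (p + 1) g = 0)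
    (hR : ∀ j, 1 ≤ j → j ≤ p → conv (conv a (reflect a)) g j = 0)
    (hsmall : ‖a‖ ^ 2 * ‖b‖ * ‖trunc (p + 1) b‖ ≤ 1 / 2) :
    ‖g - b‖ ≤ 2 * ‖a‖ ^ 2 * ‖b‖ ^ 2 * ‖trunc (p + 1) b‖ := by
  set h := g - b with hh
  set aR := reflect a with haR
  set bR := reflect b with hbR
  set τ := trunc (p + 1) b with hτ
  have habR : conv aR bR = unit 0 := by
    rw [haR, hbR, ← reflect_conv, hab, reflect_unit, neg_zero]
  have hcancel : ∀ x, conv a (conv b x) = x := fun x => by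
    rw [← conv_assoc, hab, unit_conv]
  have hcancelR : ∀ x, conv aR (conv bR x) = x := fun x => by
    rw [← conv_assoc, habR, unit_conv]
  have h0 : trunc 1 (unit 0) = 0 := by rw [trunc_unit, if_neg (by omega)]
  -- The full inverse filter solves the normal equations at every positive index, `aR` being
  -- anticausal; hence `h` inherits those of `g`.
  have hRb : conv (conv a aR) b = aR := by
    rw [conv_comm a aR, conv_assoc, hab, conv_comm, unit_conv]
  set r := conv (conv a aR) h with hr
  have hrj : ∀ j, 1 ≤ j → j ≤ p → r j = 0 := by
    intro j h1 h2
    have : r j = conv (conv a aR) g j - aR j := by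
      rw [hr, hh, map_sub, hRb]; rfl
    rw [this, hR j h1 h2, haR, reflect_apply, trunc_eq_self_iff.1 ha (-j) (by omega), sub_zero]
  set v := trunc (p + 1) r with hv
  have hvself : trunc (p + 1) v = v := trunc_trunc_of_le le_rfl r
  have hu : trunc 1 (r - v) = 0 := by
    rw [trunc_eq_zero_iff]
    intro j hj
    change r j - v j = 0
    rw [hv, trunc_apply]
    split_ifs with hjp
    · rw [sub_self]
    · rw [hrj j hj (by omega), sub_zero]
  -- the error `h` is recovered from the part `v` of its image beyond `p`
  have hhv : h = conv b (trunc 1 (conv bR v)) := by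
    -- The left side is supported on indices `≥ 1`, while `bR * (r - v)` has no mass there, so only
    -- `v` contributes.
    have e1 : conv a h = conv bR r := by
      rw [hr, conv_comm a aR, conv_assoc, ← conv_assoc, conv_comm bR aR, habR, unit_conv]
    have e2 : trunc 1 (conv a h) = conv a h := by
      simpa using trunc_conv ha hgb
    have e3 : conv bR r = conv bR (r - v) + conv bR v := by rw [map_sub]; abel
    have e4 : conv a h = trunc 1 (conv bR v) := by
      rw [← e2, e1, e3, map_add, trunc_reflect_conv hb hu, zero_add]
    rw [← e4, conv_left_comm, hcancel]
  -- the Toeplitz operator of `b * bR` on the indices beyond `p` is inverted by a factorization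
  set w := trunc (p + 1) (conv b (conv bR v)) with hw
  have hvw : v = conv a (trunc (p + 1) (conv aR w)) := by
    have e1 : trunc (p + 1) (conv b v) = conv b v := by
      simpa using trunc_conv hb hvself
    -- Split `b * bR * v` at `p + 1`: convolving the low part with `aR` leaves it below `p + 1`, so
    -- truncation removes it.
    have e2 : conv b v = conv aR w + conv aR (conv b (conv bR v) - w) := by
      rw [← map_add, add_sub_cancel, conv_left_comm b bR, hcancelR]
    have e3 : conv b v = trunc (p + 1) (conv aR w) := by
      rw [← e1, e2, map_add, trunc_reflect_conv ha (trunc_sub_trunc _ _), add_zero]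
    rw [← e3, hcancel]
  have hvle : ‖v‖ ≤ ‖a‖ ^ 2 * ‖w‖ := by
    calc ‖v‖ = ‖conv a (trunc (p + 1) (conv aR w))‖ := by rw [← hvw]
      _ ≤ ‖a‖ * ‖trunc (p + 1) (conv aR w)‖ := norm_conv_le _ _
      _ ≤ ‖a‖ * (‖a‖ * ‖w‖) := by
        gcongr
        exact (norm_trunc_le _ _).trans ((norm_conv_le _ _).trans
          (mul_le_mul_of_nonneg_right (norm_reflect_le a) (norm_nonneg _)))
      _ = ‖a‖ ^ 2 * ‖w‖ := by ring
  -- the part of `bR * v` at nonpositive indices only involves the tail of `b`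
  have hneg : conv bR v - trunc 1 (conv bR v) =
      conv (reflect τ) v - trunc 1 (conv (reflect τ) v) := by
    have e1 : trunc 1 (conv (reflect (b - τ)) v) = conv (reflect (b - τ)) v := by
      have : trunc (-p) (reflect (b - τ)) = reflect (b - τ) := by
        rw [trunc_eq_self_iff]
        intro j hj
        rw [reflect_apply]
        exact trunc_eq_zero_iff.1 (trunc_sub_trunc (p + 1) b) (-j) (by omega)
      have := trunc_conv this hvself
      rwa [show -p + (p + 1) = 1 by ring] at this
    have e2 : conv bR v = conv (reflect τ) v + conv (reflect (b - τ)) v := by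
      rw [hbR, map_sub, map_sub]
      simp
    rw [e2, map_add, e1]
    abel
  have hnegle : ‖conv bR v - trunc 1 (conv bR v)‖ ≤ ‖τ‖ * ‖v‖ := by
    have : ∀ x : EllOne, ‖x - trunc 1 x‖ ≤ ‖x‖ := fun x => by
      refine (hasSum_norm _).tsum_eq ▸ (hasSum_norm x).tsum_eq ▸
        (hasSum_norm _).summable.tsum_le_tsum (fun k => ?_) (hasSum_norm x).summable
      change ‖x k - trunc 1 x k‖ ≤ _
      rw [trunc_apply]
      split_ifs <;> simp
    rw [hneg]
    exact (this _).trans ((norm_conv_le _ _).trans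
          (mul_le_mul_of_nonneg_right (norm_reflect_le τ) (norm_nonneg _)))
  have hwle : ‖w‖ ≤ ‖τ‖ + ‖b‖ * (‖τ‖ * ‖v‖) := by
    -- Since `g` vanishes beyond `p`, the truncation of `h = g - b` there is exactly `-τ`.
    have e : w = -τ + trunc (p + 1) (conv b (conv bR v - trunc 1 (conv bR v))) := by
      rw [map_sub, ← hhv, map_sub, ← hw, hh, map_sub, hg]
      abel
    rw [e]
    refine (norm_add_le _ _).trans ?_
    rw [norm_neg]
    gcongr
    exact (norm_trunc_le _ _).trans ((norm_conv_le _ _).trans (by gcongr))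
  -- The bounds on `v` and `w` are circular; the smallness of the tail lets half of `‖v‖` be
  -- absorbed on the left.
  have hv2 : ‖v‖ ≤ 2 * ‖a‖ ^ 2 * ‖τ‖ := by
    have e1 : ‖v‖ ≤ ‖a‖ ^ 2 * (‖τ‖ + ‖b‖ * (‖τ‖ * ‖v‖)) := hvle.trans (by gcongr)
    have e2 : ‖a‖ ^ 2 * ‖b‖ * ‖τ‖ * ‖v‖ ≤ 1 / 2 * ‖v‖ := by gcongr
    linarith
  calc ‖h‖ = ‖conv b (trunc 1 (conv bR v))‖ := by rw [← hhv]
    _ ≤ ‖b‖ * ‖trunc 1 (conv bR v)‖ := norm_conv_le _ _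
    _ ≤ ‖b‖ * (‖b‖ * ‖v‖) := by
        gcongr
        exact (norm_trunc_le _ _).trans ((norm_conv_le _ _).trans
          (mul_le_mul_of_nonneg_right (norm_reflect_le b) (norm_nonneg _)))
    _ ≤ ‖b‖ * (‖b‖ * (2 * ‖a‖ ^ 2 * ‖τ‖)) := by gcongr
    _ = 2 * ‖a‖ ^ 2 * ‖b‖ ^ 2 * ‖τ‖ := by ring

/-! ### Wiener's lemma for causal sequences -/

/-- The Banach algebra generated by the unit shift. -/
abbrev shiftAlgebra : Subalgebra ℂ (EllOne →L[ℂ] EllOne) := Algebra.elemental ℂ (shift 1)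

instance : NormedCommRing shiftAlgebra :=
  { (inferInstance : NormedRing shiftAlgebra) with
    mul_comm := fun x y => mul_comm x y }

instance : Nontrivial EllOne := ⟨⟨unit 0, 0, fun h => by
  have := norm_unit 0
  rw [h, norm_zero] at this
  exact zero_ne_one this⟩⟩

/-- The generator of the algebra `shiftAlgebra`. -/
def shiftGen : shiftAlgebra := ⟨shift 1, Algebra.elemental.self_mem ℂ (shift 1)⟩

theorem norm_shiftGen_le : ‖shiftGen‖ ≤ 1 := norm_shift_le 1

theorem norm_shiftAlgebra_one : ‖(1 : shiftAlgebra)‖ = 1 :=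
  (norm_one : ‖(1 : EllOne →L[ℂ] EllOne)‖ = 1)

/-- The nonnegative powers of the shift, extended by zero. -/
def causalPow (k : ℤ) : shiftAlgebra := if 0 ≤ k then shiftGen ^ k.toNat else 0

theorem norm_causalPow_le (k : ℤ) : ‖causalPow k‖ ≤ 1 := by
  unfold causalPow
  split_ifs
  · rcases Nat.eq_zero_or_pos k.toNat with h | h
    · rw [h, pow_zero, norm_shiftAlgebra_one]
    · exact (norm_pow_le' _ h).trans (pow_le_one₀ (norm_nonneg _) norm_shiftGen_le)
  · simp

/-- The convolution operators by causal sequences, as elements of the algebra of the shift. -/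
def causalConv : EllOne →L[ℂ] shiftAlgebra := lift causalPow 1 norm_causalPow_le

theorem shift_one_pow (n : ℕ) : shift 1 ^ n = shift n := by
  induction n with
  | zero => exact ext_unit fun k => by simp
  | succ n ih =>
    rw [pow_succ, ih]
    exact ext_unit fun k => by simp [add_assoc, add_comm (1 : ℤ)]

theorem coe_causalConv (x : EllOne) : (causalConv x : EllOne →L[ℂ] EllOne) = conv (trunc 0 x) := by
  have : (shiftAlgebra.toSubmodule.subtypeL).comp causalConv = conv.comp (trunc 0) := by
    refine ext_unit fun k => ?_
    simp only [ContinuousLinearMap.comp_apply, trunc_unit, causalConv, lift_unit, causalPow]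
    split_ifs with h
    · change (shift 1) ^ k.toNat = _
      rw [shift_one_pow, conv_unit, Int.toNat_of_nonneg h]
    · simp
  exact DFunLike.congr_fun this x

/-- The operators preserving causality form a closed subalgebra containing the shift. This is what
makes the inverse found in `shiftAlgebra` causal. -/
theorem trunc_shiftAlgebra (T : shiftAlgebra) {x : EllOne} (hx : trunc 0 x = x) :
    trunc 0 ((T : EllOne →L[ℂ] EllOne) x) = (T : EllOne →L[ℂ] EllOne) x := by
  let A : Subalgebra ℂ (EllOne →L[ℂ] EllOne) :=
    { carrier := {T | ∀ x, trunc 0 x = x → trunc 0 (T x) = T x}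
      mul_mem' := fun {S T} hS hT x hx => hS _ (hT x hx)
      add_mem' := fun {S T} hS hT x hx => by
        rw [add_apply, map_add, hS x hx, hT x hx]
      algebraMap_mem' := fun c x hx => by
        change trunc 0 (c • x) = c • x
        rw [map_smul, hx] }
  have hA : IsClosed (A : Set (EllOne →L[ℂ] EllOne)) := by
    change IsClosed {T : EllOne →L[ℂ] EllOne | ∀ x, trunc 0 x = x → trunc 0 (T x) = T x}
    simp only [Set.ofPred_forall]
    refine isClosed_iInter fun x => isClosed_iInter fun _ => isClosed_eq ?_ ?_ <;> fun_prop
  have hle : shiftAlgebra ≤ A := Algebra.elemental.le_of_mem hA (by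
    intro x hx
    rw [trunc_eq_self_iff] at *
    intro j hj
    rw [shift_apply]
    exact hx _ (by omega))
  exact hle T.2 x hx

/-- Wiener's lemma for causal sequences: a causal sequence whose power series has no zero in the
closed unit disc has a causal inverse for convolution. -/
theorem exists_causal_inverse {a : EllOne} (ha : trunc 0 a = a)
    (hz : ∀ z : ℂ, ‖z‖ ≤ 1 → ∑' k : ℕ, a k * z ^ k ≠ 0) :
    ∃ b, trunc 0 b = b ∧ conv a b = unit 0 := by
  have hunit : IsUnit (causalConv a) := by
    by_contra hcon
    -- By Gelfand theory a non-invertible element is killed by a character. With `z` its value at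
    -- the shift, `‖z‖ ≤ 1` and the character sends `∑ a k • shift ^ k` to `∑ a k * z ^ k`.
    obtain ⟨φ, hφ⟩ := WeakDual.CharacterSpace.exists_apply_eq_zero hcon
    set z := φ shiftGen with hzdef
    have hz1 : ‖z‖ ≤ 1 := by
      have := AlgHom.norm_apply_le_self_mul_norm_one φ shiftGen
      rw [norm_shiftAlgebra_one, mul_one] at this
      exact this.trans norm_shiftGen_le
    apply hz z hz1
    have h1 := (lift_hasSum causalPow 1 norm_causalPow_le a).mapL (WeakDual.CharacterSpace.toCLM φ)
    have h2 : HasSum (fun k : ℕ => a k * z ^ k) (φ (causalConv a)) := by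
      rw [← Function.Injective.hasSum_iff (g := ((↑) : ℕ → ℤ)) Nat.cast_injective] at h1
      · refine (congrArg (HasSum · _) (funext fun k => ?_)).mpr h1
        change a k * z ^ k = WeakDual.CharacterSpace.toCLM φ (a k • causalPow k)
        rw [map_smul, smul_eq_mul, causalPow, if_pos (Int.natCast_nonneg k), Int.toNat_natCast]
        exact congrArg (a k * ·) (map_pow φ shiftGen k).symm
      · intro k hk
        have : ¬ 0 ≤ k := fun h => hk ⟨k.toNat, Int.toNat_of_nonneg h⟩
        simp [causalPow, this]
    rw [h2.tsum_eq, hφ]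
  obtain ⟨T, hT⟩ := hunit.exists_right_inv
  refine ⟨(T : EllOne →L[ℂ] EllOne) (unit 0), trunc_shiftAlgebra T ?_, ?_⟩
  · rw [trunc_unit, if_pos le_rfl]
  · have h : ((causalConv a * T : shiftAlgebra) : EllOne →L[ℂ] EllOne) (unit 0) = unit 0 := by
      rw [hT]; rfl
    rw [← ha, ← coe_causalConv]
    exact h

end EllOne

/-! ### Joint stationarity -/

namespace WSS

variable {Ω : Type*} [MeasurableSpace Ω] {P : Measure Ω}

theorem integral_mul_eq_inner (f g : Lp ℝ 2 P) : ∫ ω, f ω * g ω ∂P = inner ℝ f g := by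
  rw [real_inner_comm, L2.inner_def]
  simp

theorem cov_eq_inner (X : ℤ → Lp ℝ 2 P) (k : ℤ) : cov X k = inner ℝ (X k) (X 0) :=
  integral_mul_eq_inner _ _

/-- The inner products of two sequences are invariant under simultaneous translations. -/
def JointlyStationary (X Y : ℤ → Lp ℝ 2 P) : Prop :=
  ∀ n m k, inner ℝ (X (n + k)) (Y (m + k)) = inner ℝ (X n) (Y m)

theorem IsWSS.jointlyStationary {X : ℤ → Lp ℝ 2 P} (hX : IsWSS X) : JointlyStationary X X := by
  intro n m k
  have h := hX.stationary (m + k) m (n - m)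
  rw [integral_mul_eq_inner, integral_mul_eq_inner] at h
  rwa [show m + k + (n - m) = n + k by ring, show m + (n - m) = n by ring] at h

namespace JointlyStationary

variable {X Y : ℤ → Lp ℝ 2 P}

theorem symm (h : JointlyStationary X Y) : JointlyStationary Y X := fun n m k => by
  rw [real_inner_comm, h, real_inner_comm]

theorem inner_eq (h : JointlyStationary X Y) (n m : ℤ) :
    inner ℝ (X n) (Y m) = inner ℝ (X (n - m)) (Y 0) := by
  rw [← h (n - m) 0 m, sub_add_cancel, zero_add]

theorem sub_left {Z : ℤ → Lp ℝ 2 P} (hX : JointlyStationary X Y) (hZ : JointlyStationary Z Y) :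
    JointlyStationary (fun n => X n - Z n) Y := fun n m k => by
  rw [inner_sub_left, inner_sub_left, hX, hZ]

theorem sum_left (h : JointlyStationary X Y) (s : Finset ℕ) (c : ℕ → ℝ) :
    JointlyStationary (fun n => ∑ j ∈ s, c j • X (n - 1 - j)) Y := fun n m k => by
  simp only [sum_inner, real_inner_smul_left]
  refine Finset.sum_congr rfl fun j _ => ?_
  rw [← h (n - 1 - j) m k]
  congr 3
  ring_nf

theorem of_tendsto {Z : ℕ → ℤ → Lp ℝ 2 P} (h : ∀ p, JointlyStationary (Z p) Y)
    (hZ : ∀ n, Tendsto (fun p => Z p n) atTop (𝓝 (X n))) : JointlyStationary X Y := fun n m k => by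
  refine tendsto_nhds_unique ((hZ (n + k)).inner tendsto_const_nhds) ?_
  simp only [h _ n m k]
  exact (hZ n).inner tendsto_const_nhds

end JointlyStationary

/-! ### Past subspaces -/

section Past

variable (X : ℤ → Lp ℝ 2 P)

theorem mem_past {p : ℕ∞} {j : ℕ} (hj : (j : ℕ∞) < p) (n : ℤ) : X (n - j) ∈ past X p n :=
  Submodule.le_topologicalClosure _ (Submodule.subset_span ⟨j, hj, rfl⟩)

theorem mem_past_top {m n : ℤ} (h : m ≤ n) : X m ∈ past X ⊤ n := by
  have := mem_past X (p := ⊤) (j := (n - m).toNat) (ENat.natCast_lt_top _) n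
  rwa [Int.toNat_of_nonneg (by omega), sub_sub_cancel] at this

variable {X}

theorem past_le {p : ℕ∞} {n : ℤ} {K : Submodule ℝ (Lp ℝ 2 P)} (hK : IsClosed (K : Set (Lp ℝ 2 P)))
    (h : ∀ j : ℕ, (j : ℕ∞) < p → X (n - j) ∈ K) : past X p n ≤ K := by
  refine Submodule.topologicalClosure_minimal _ (Submodule.span_le.2 ?_) hK
  rintro _ ⟨j, hj, rfl⟩
  exact h j hj

theorem isClosed_past (p : ℕ∞) (n : ℤ) : IsClosed (past X p n : Set (Lp ℝ 2 P)) :=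
  Submodule.isClosed_topologicalClosure _

theorem inner_eq_zero_of_mem_past {p : ℕ∞} {n : ℤ} {Y Z : Lp ℝ 2 P} (hY : Y ∈ past X p n)
    (h : ∀ j : ℕ, (j : ℕ∞) < p → inner ℝ (X (n - j)) Z = 0) : inner ℝ Y Z = 0 := by
  have hle : past X p n ≤ (ℝ ∙ Z)ᗮ := past_le (Submodule.isClosed_orthogonal _) fun j hj => by
    rw [Submodule.mem_orthogonal_singleton_iff_inner_left]
    exact h j hj
  exact Submodule.mem_orthogonal_singleton_iff_inner_left.1 (hle hY)

theorem past_top_mono : Monotone (past X ⊤) := fun m n h =>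
  past_le (isClosed_past _ _) fun j _ => mem_past_top X (by omega)

theorem past_mono_order (n : ℤ) : Monotone fun p : ℕ∞ => past X p n := fun _ _ h =>
  past_le (isClosed_past _ _) fun _ hj => mem_past X (hj.trans_le h) n

theorem mem_past_nat_iff {p : ℕ} {n : ℤ} {Y : Lp ℝ 2 P} :
    Y ∈ past X p n ↔ ∃ c : ℕ → ℝ, Y = ∑ j ∈ Finset.range p, c j • X (n - j) := by
  constructor
  · intro hY
    have hset : {Y | ∃ j : ℕ, (j : ℕ∞) < p ∧ Y = X (n - j)} =
        (fun j : ℕ => X (n - j)) '' (Finset.range p : Set ℕ) := by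
      ext Z
      simp [eq_comm]
    have hfin : FiniteDimensional ℝ
        (Submodule.span ℝ ((fun j : ℕ => X (n - j)) '' (Finset.range p : Set ℕ))) :=
      FiniteDimensional.span_of_finite ℝ ((Finset.finite_toSet _).image _)
    rw [past, hset, (Submodule.closed_of_finiteDimensional _).submodule_topologicalClosure_eq,
      Submodule.mem_span_image_finset_iff_exists_fun] at hY
    obtain ⟨c, hc⟩ := hY
    refine ⟨fun j => if h : j ∈ Finset.range p then c ⟨j, h⟩ else 0, ?_⟩
    refine hc.symm.trans (Eq.trans ?_ (Finset.sum_coe_sort _ _))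
    exact Finset.sum_congr rfl fun j _ => by simp [-Finset.mem_range]
  · rintro ⟨c, rfl⟩
    exact Submodule.sum_mem _ fun j hj => Submodule.smul_mem _ _
      (mem_past X (by simpa using hj) n)

theorem past_top_eq (n : ℤ) :
    past X ⊤ n = (⨆ p : ℕ, past X p n).topologicalClosure := by
  refine le_antisymm (past_le (Submodule.isClosed_topologicalClosure _) fun j _ => ?_) ?_
  · refine Submodule.le_topologicalClosure _ (Submodule.mem_iSup_of_mem (j + 1) ?_)
    exact mem_past X (by exact_mod_cast Nat.lt_succ_self j) n
  · exact Submodule.topologicalClosure_minimal _ (iSup_le fun p => past_mono_order n le_top)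
      (isClosed_past _ _)

end Past

/-! ### Predictors and innovations -/

section Predictor

variable {X : ℤ → Lp ℝ 2 P}

theorem predictor_mem (p : ℕ∞) (n : ℤ) : predictor X p n ∈ past X p (n - 1) :=
  Submodule.starProjection_apply_mem _ _

theorem inner_sub_predictor {p : ℕ∞} {n : ℤ} {Y : Lp ℝ 2 P} (hY : Y ∈ past X p (n - 1)) :
    inner ℝ Y (X n - predictor X p n) = 0 :=
  Submodule.inner_right_of_mem_orthogonal hY (Submodule.sub_starProjection_mem_orthogonal (X n))

theorem predictor_eq_of_inner {p : ℕ∞} {n : ℤ} {Y : Lp ℝ 2 P} (hY : Y ∈ past X p (n - 1))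
    (h : ∀ j : ℕ, (j : ℕ∞) < p → inner ℝ (X (n - 1 - j)) (X n - Y) = 0) : predictor X p n = Y := by
  refine Submodule.eq_starProjection_of_mem_of_inner_eq_zero hY fun Z hZ => ?_
  rw [real_inner_comm]
  exact inner_eq_zero_of_mem_past hZ h

/-- Projections onto an increasing family of subspaces converge strongly to the projection onto the
closure of the union. -/
theorem tendsto_predictor (X : ℤ → Lp ℝ 2 P) (n : ℤ) :
    Tendsto (fun p : ℕ => predictor X p n) atTop (𝓝 (predictor X ⊤ n)) := by
  have h := Submodule.starProjection_tendsto_closure_iSup (fun p : ℕ => past X p (n - 1))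
    (fun p q hpq => past_mono_order (n - 1) (by exact_mod_cast hpq)) (X n)
  convert! h using 2
  unfold predictor
  congr 1
  simp only [past_top_eq]

/-- The coefficients of the predictor of finite order do not depend on time. -/
theorem exists_predictor_eq_sum (hX : JointlyStationary X X) (p : ℕ) :
    ∃ c : ℕ → ℝ, ∀ n, predictor X p n = ∑ j ∈ Finset.range p, c j • X (n - 1 - j) := by
  obtain ⟨c, hc⟩ := mem_past_nat_iff.1 (predictor_mem (X := X) p 0)
  -- The coefficients found at time `0` satisfy the orthogonality relations at time `n`, by
  -- stationarity.
  refine ⟨c, fun n => predictor_eq_of_inner (mem_past_nat_iff.2 ⟨c, rfl⟩) fun j hj => ?_⟩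
  have h0 := inner_sub_predictor (n := 0) (mem_past X hj (0 - 1))
  rw [← h0, hc, real_inner_comm, real_inner_comm (X 0 - _)]
  have := hX.sub_left (hX.sum_left (Finset.range p) c) 0 (0 - 1 - j) n
  simpa only [zero_add, show (0 - 1 - (j : ℤ)) + n = n - 1 - j by ring] using this

/-- At finite order the predictor is a time-invariant filter of `X`; infinite order follows by
passing to the limit. -/
theorem predictor_jointlyStationary_left {Y : ℤ → Lp ℝ 2 P} (hX : JointlyStationary X X)
    (hXY : JointlyStationary X Y) (p : ℕ∞) : JointlyStationary (predictor X p) Y := by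
  have hfin : ∀ p : ℕ, JointlyStationary (predictor X p) Y := fun p => by
    obtain ⟨c, hc⟩ := exists_predictor_eq_sum hX p
    rw [funext hc]
    exact hXY.sum_left _ c
  induction p using ENat.recTopCoe with
  | top => exact .of_tendsto hfin (tendsto_predictor X)
  | coe p => exact hfin p

theorem predictor_jointlyStationary (hX : JointlyStationary X X) (p : ℕ∞) :
    JointlyStationary (predictor X p) (predictor X p) :=
  predictor_jointlyStationary_left hX (predictor_jointlyStationary_left hX hX p).symm p

theorem innovation_jointlyStationary_left {Y : ℤ → Lp ℝ 2 P} (hX : JointlyStationary X X)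
    (hXY : JointlyStationary X Y) : JointlyStationary (innovation X) Y :=
  hXY.sub_left (predictor_jointlyStationary_left hX hXY ⊤)

theorem IsWSS.predictor [IsProbabilityMeasure P] (hX : IsWSS X) (p : ℕ∞) :
    IsWSS (predictor X p) where
  mean_zero n := by
    -- Zero mean is orthogonality to the constant `1`, which passes from `X` to its closed span.
    let I : Lp ℝ 2 P := indicatorConstLp 2 MeasurableSet.univ (measure_ne_top P _) (1 : ℝ)
    have hI : ∀ f : Lp ℝ 2 P, inner ℝ I f = ∫ ω, f ω ∂P := fun f => by
      rw [L2.inner_indicatorConstLp_one, Measure.restrict_univ]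
    rw [← hI, real_inner_comm]
    refine inner_eq_zero_of_mem_past (predictor_mem p n) fun j _ => ?_
    rw [real_inner_comm, hI, hX.mean_zero]
  stationary n m k := by
    rw [integral_mul_eq_inner, integral_mul_eq_inner]
    have h := predictor_jointlyStationary hX.jointlyStationary p (m + k) m (n - m)
    rwa [show m + k + (n - m) = n + k by ring, show m + (n - m) = n by ring] at h

theorem innovation_mem (X : ℤ → Lp ℝ 2 P) (n : ℤ) : innovation X n ∈ past X ⊤ n :=
  Submodule.sub_mem _ (mem_past_top X le_rfl) (past_top_mono (by omega) (predictor_mem ⊤ n))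

theorem inner_innovation_of_mem {m n : ℤ} {Y : Lp ℝ 2 P} (hY : Y ∈ past X ⊤ m) (hmn : m < n) :
    inner ℝ Y (innovation X n) = 0 :=
  inner_sub_predictor (past_top_mono (by omega) hY)

theorem inner_self_innovation (X : ℤ → Lp ℝ 2 P) (n : ℤ) :
    inner ℝ (X n) (innovation X n) = inner ℝ (innovation X n) (innovation X n) := by
  have h : X n = innovation X n + predictor X ⊤ n := by rw [innovation, sub_add_cancel]
  nth_rw 1 [h]
  rw [inner_add_left, inner_innovation_of_mem (predictor_mem ⊤ n) (by omega), add_zero]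

/-- Removing the component along the last innovation sends the past at time `n` to the past at
time `n - 1`. -/
theorem sub_smul_innovation_mem {n : ℤ} {Y : Lp ℝ 2 P} (hY : Y ∈ past X ⊤ n) {c : ℝ}
    (hc : inner ℝ Y (innovation X n) = c * inner ℝ (innovation X n) (innovation X n)) :
    Y - c • innovation X n ∈ past X ⊤ (n - 1) := by
  set Q := (past X ⊤ (n - 1)).starProjection Y with hQ
  have hQm : Q ∈ past X ⊤ (n - 1) := Submodule.starProjection_apply_mem _ _
  -- The remainder `Z` lies in the past at time `n` and is orthogonal to the earlier past and to the
  -- innovation, hence to itself.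
  set Z := Y - c • innovation X n - Q with hZ
  have hZm : Z ∈ past X ⊤ n := Submodule.sub_mem _ (Submodule.sub_mem _ hY
    (Submodule.smul_mem _ _ (innovation_mem X n))) (past_top_mono (by omega) hQm)
  have horth : ∀ W ∈ past X ⊤ (n - 1), inner ℝ W Z = 0 := fun W hW => by
    have h1 : inner ℝ W (Y - Q) = 0 :=
      Submodule.inner_right_of_mem_orthogonal hW (Submodule.sub_starProjection_mem_orthogonal Y)
    rw [hZ, sub_right_comm, inner_sub_right, h1, inner_smul_right,
      inner_innovation_of_mem hW (by omega), mul_zero, sub_zero]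
  have hν : inner ℝ (innovation X n) Z = 0 := by
    rw [real_inner_comm, hZ, inner_sub_left, inner_sub_left, hc, real_inner_smul_left, sub_self,
      inner_innovation_of_mem hQm (by omega), sub_zero]
  have hZ0 : inner ℝ Z Z = 0 := by
    refine inner_eq_zero_of_mem_past hZm fun j _ => ?_
    rcases Nat.eq_zero_or_pos j with rfl | hj
    · have h : X n = innovation X n + predictor X ⊤ n := by rw [innovation, sub_add_cancel]
      rw [Nat.cast_zero, sub_zero, h, inner_add_left, hν, horth _ (predictor_mem ⊤ n), add_zero]
    · exact horth _ (mem_past_top X (by omega))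
  rw [inner_self_eq_zero, hZ, sub_eq_zero] at hZ0
  rw [hZ0]
  exact hQm

end Predictor

end WSS

/-! ### Fourier series of `ℓ¹` sequences -/

namespace EllOne

/-- The Fourier series of a sequence in `ℓ¹(ℤ)`, evaluated at the frequency `t`. -/
def fourierSum (t : ℝ) : EllOne →L[ℂ] ℂ :=
  lift (fun k => Complex.exp (-2 * Real.pi * Complex.I * t * k)) 1 fun k => by
    rw [Complex.norm_exp]
    simp

theorem fourierSum_apply (t : ℝ) (x : EllOne) :
    fourierSum t x = ∑' k : ℤ, x k * Complex.exp (-2 * Real.pi * Complex.I * t * k) := rfl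

theorem norm_fourierSum_le (t : ℝ) (x : EllOne) : ‖fourierSum t x‖ ≤ ‖x‖ :=
  (norm_lift_apply_le _ 1 _ x).trans_eq (one_mul _)

theorem continuous_fourierSum (x : EllOne) : Continuous fun t => fourierSum t x := by
  simp only [fourierSum_apply]
  refine continuous_tsum (fun k => by fun_prop) (hasSum_norm x).summable fun k t => ?_
  rw [norm_mul, Complex.norm_exp]
  simp

theorem fourierSum_conv (t : ℝ) (x y : EllOne) :
    fourierSum t (conv x y) = fourierSum t x * fourierSum t y := by
  have : (ContinuousLinearMap.compL ℂ EllOne EllOne ℂ (fourierSum t)).comp conv =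
      ((ContinuousLinearMap.mul ℂ ℂ).flip.comp (fourierSum t)).flip.comp (fourierSum t) := by
    refine ext_unit fun j => ext_unit fun k => ?_
    simp only [ContinuousLinearMap.comp_apply, ContinuousLinearMap.compL_apply, conv_unit,
      shift_unit, ContinuousLinearMap.flip_apply, ContinuousLinearMap.mul_apply', fourierSum,
      lift_unit, ← Complex.exp_add]
    congr 1
    push_cast
    ring
  exact DFunLike.congr_fun (DFunLike.congr_fun this x) y

theorem fourierSum_reflect (t : ℝ) (x : EllOne) : fourierSum t (reflect x) = fourierSum (-t) x := by
  have : (fourierSum t).comp reflect = fourierSum (-t) := by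
    refine ext_unit fun k => ?_
    simp [fourierSum]
  exact DFunLike.congr_fun this x

theorem fourierSum_causal (t : ℝ) {x : EllOne} (hx : trunc 0 x = x) :
    HasSum (fun k : ℕ => x k * Complex.exp (-2 * Real.pi * Complex.I * t) ^ k) (fourierSum t x) := by
  have h := lift_hasSum (fun k : ℤ => Complex.exp (-2 * Real.pi * Complex.I * t * k)) 1
    (fun k => by rw [Complex.norm_exp]; simp) x
  rw [← Function.Injective.hasSum_iff (g := ((↑) : ℕ → ℤ)) Nat.cast_injective] at h
  · refine (congrArg (HasSum · _) (funext fun k => ?_)).mpr h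
    simp only [Function.comp_apply, smul_eq_mul, ← Complex.exp_nat_mul]
    congr 2
    push_cast
    ring
  · intro k hk
    rw [trunc_eq_self_iff.1 hx k (by
      by_contra hcon
      exact hk ⟨k.toNat, Int.toNat_of_nonneg (by omega)⟩), zero_smul]

end EllOne

/-! ### Wold decomposition -/

namespace WSS

open EllOne

variable {Ω : Type*} [MeasurableSpace Ω] {P : Measure Ω} {X : ℤ → Lp ℝ 2 P}

theorem inner_innovation_self (hX : JointlyStationary X X) (n : ℤ) :
    inner ℝ (innovation X n) (innovation X n) = inner ℝ (innovation X 0) (innovation X 0) := by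
  have h := innovation_jointlyStationary_left hX (innovation_jointlyStationary_left hX hX).symm
  simpa using h.inner_eq n n

theorem norm_innovation (hX : JointlyStationary X X) (n : ℤ) :
    ‖innovation X n‖ = ‖innovation X 0‖ := by
  have := inner_innovation_self hX n
  rw [real_inner_self_eq_norm_sq, real_inner_self_eq_norm_sq] at this
  exact (sq_eq_sq₀ (norm_nonneg _) (norm_nonneg _)).1 this

/-- If one innovation vanishes, all do by stationarity; all pasts then coincide, and `X 0` lies in
the trivial remote past. -/
theorem innovation_ne_zero (hX : JointlyStationary X X) (hreg : IsRegular X) (h0 : X 0 ≠ 0) :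
    innovation X 0 ≠ 0 := by
  intro hν
  have hall : ∀ n, innovation X n = 0 := fun n => by
    rw [← inner_self_eq_zero (𝕜 := ℝ), inner_innovation_self hX n, hν, inner_zero_left]
  have hstep : ∀ n, past X ⊤ n ≤ past X ⊤ (n - 1) := fun n => by
    refine past_le (isClosed_past _ _) fun j _ => ?_
    rcases Nat.eq_zero_or_pos j with rfl | hj
    · rw [Nat.cast_zero, sub_zero, sub_eq_zero.1 (hall n)]
      exact predictor_mem ⊤ n
    · exact mem_past_top X (by omega)
  have hmem : ∀ N : ℕ, X 0 ∈ past X ⊤ (-N) := fun N => by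
    induction N with
    | zero => simpa using mem_past_top X (le_refl 0)
    | succ N ih =>
      have := hstep _ ih
      rwa [show -(N : ℤ) - 1 = -((N + 1 : ℕ) : ℤ) by push_cast; ring] at this
  refine h0 ((Submodule.mem_bot ℝ).1 (hreg ▸ (Submodule.mem_iInf _).2 fun n => ?_))
  exact past_top_mono (by omega) (hmem n.natAbs)

theorem woldCoeff_eq (hX : JointlyStationary X X) (k : ℕ) :
    woldCoeff X k =
      inner ℝ (X 0) (innovation X (-k)) / inner ℝ (innovation X 0) (innovation X 0) := by
  rw [woldCoeff, integral_mul_eq_inner, ← inner_innovation_self hX (-k)]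
  simp only [pow_two, integral_mul_eq_inner]

/-- The Wold coefficients as a causal sequence in `ℓ¹(ℤ)`. -/
def woldSeq (X : ℤ → Lp ℝ 2 P) (ha : Summable fun k : ℕ => |woldCoeff X k|) : EllOne :=
  ofSummable (fun k => if 0 ≤ k then (woldCoeff X k.toNat : ℂ) else 0) (by
    rw [← Function.Injective.summable_iff (g := ((↑) : ℕ → ℤ)) Nat.cast_injective]
    · simpa [Function.comp_def] using ha
    · intro k hk
      have : ¬ 0 ≤ k := fun h => hk ⟨k.toNat, Int.toNat_of_nonneg h⟩
      simp [this])

/-- The Wold decomposition at time `0`. -/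
theorem hasSum_wold (ha : Summable fun k : ℕ => |woldCoeff X k|)
    (hX : JointlyStationary X X) (hreg : IsRegular X)
    (hν : innovation X 0 ≠ 0) :
    HasSum (fun k : ℕ => woldCoeff X k • innovation X (-k)) (X 0) := by
  have hs : inner ℝ (innovation X 0) (innovation X 0) ≠ 0 := inner_self_ne_zero.2 hν
  have hsum : Summable fun k : ℕ => woldCoeff X k • innovation X (-k) := by
    refine Summable.of_norm_bounded (ha.mul_right ‖innovation X 0‖) fun k => ?_
    rw [norm_smul, norm_innovation hX, Real.norm_eq_abs]
  have hpart : ∀ N : ℕ,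
      X 0 - ∑ k ∈ Finset.range N, woldCoeff X k • innovation X (-k) ∈ past X ⊤ (-N) := by
    intro N
    induction N with
    | zero => simpa using mem_past_top X (le_refl 0)
    | succ N ih =>
      rw [Finset.sum_range_succ, ← sub_sub,
        show -((N + 1 : ℕ) : ℤ) = -(N : ℤ) - 1 by push_cast; ring]
      refine sub_smul_innovation_mem ih ?_
      rw [inner_sub_left, sum_inner, Finset.sum_eq_zero, sub_zero, woldCoeff_eq hX,
        inner_innovation_self hX (-N), div_mul_cancel₀ _ hs]
      intro k hk
      rw [Finset.mem_range] at hk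
      rw [real_inner_smul_left, inner_innovation X (by omega), mul_zero]
  -- The limiting remainder belongs to every past, so regularity kills it.
  have hzero : X 0 - ∑' k : ℕ, woldCoeff X k • innovation X (-k) = 0 := by
    refine (Submodule.mem_bot ℝ).1 (hreg ▸ (Submodule.mem_iInf _).2 fun n => ?_)
    refine past_top_mono (show -(n.natAbs : ℤ) ≤ n by omega) ?_
    have hlim := (tendsto_const_nhds (x := X 0)).sub hsum.hasSum.tendsto_sum_nat
    refine (isClosed_past _ _).mem_of_tendsto hlim ?_
    filter_upwards [eventually_ge_atTop n.natAbs] with N hN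
    exact past_top_mono (by omega) (hpart N)
  rw [sub_eq_zero.1 hzero]
  exact hsum.hasSum

section Wold

variable (ha : Summable fun k : ℕ => |woldCoeff X k|)

theorem woldSeq_natCast (k : ℕ) : woldSeq X ha k = woldCoeff X k := by simp [woldSeq]

theorem woldSeq_of_neg {k : ℤ} (hk : k < 0) : woldSeq X ha k = 0 := by
  simp [woldSeq, not_le.2 hk]

theorem trunc_woldSeq : trunc 0 (woldSeq X ha) = woldSeq X ha :=
  trunc_eq_self_iff.2 fun _ hj => woldSeq_of_neg ha hj

theorem inner_innovation_eq (hX : JointlyStationary X X) (hν : innovation X 0 ≠ 0) (n m : ℤ) :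
    (inner ℝ (X n) (innovation X m) : ℂ) =
      (inner ℝ (innovation X 0) (innovation X 0) : ℝ) * woldSeq X ha (n - m) := by
  rcases lt_or_ge (n - m) 0 with h | h
  · rw [woldSeq_of_neg ha h, inner_innovation_of_mem (mem_past_top X le_rfl) (by omega)]
    simp
  · obtain ⟨k, hk⟩ := Int.eq_ofNat_of_zero_le h
    have hs : inner ℝ (innovation X 0) (innovation X 0) ≠ 0 := inner_self_ne_zero.2 hν
    have hst := (innovation_jointlyStationary_left hX hX).symm 0 (-k) n
    rw [show -(k : ℤ) + n = m by omega, zero_add] at hst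
    rw [hk, woldSeq_natCast, woldCoeff_eq hX, hst, ← Complex.ofReal_mul, mul_div_cancel₀ _ hs]

theorem woldSeq_zero (hX : JointlyStationary X X) (hν : innovation X 0 ≠ 0) :
    woldSeq X ha 0 = 1 := by
  have h := woldSeq_natCast ha 0
  rw [Nat.cast_zero] at h
  rw [h, woldCoeff_eq hX, Nat.cast_zero, neg_zero, inner_self_innovation,
    div_self (inner_self_ne_zero.2 hν), Complex.ofReal_one]

/-- The covariances of `X` are the autocorrelations of the Wold coefficients. -/
theorem cov_eq_conv (hX : JointlyStationary X X) (hreg : IsRegular X) (hν : innovation X 0 ≠ 0)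
    (k : ℤ) :
    (cov X k : ℂ) = ((inner ℝ (innovation X 0) (innovation X 0) : ℝ) : ℂ) *
      conv (woldSeq X ha) (reflect (woldSeq X ha)) k := by
  set s : ℂ := ((inner ℝ (innovation X 0) (innovation X 0) : ℝ) : ℂ) with hs
  have h1 : HasSum (fun i : ℕ => inner ℝ (X k) (woldCoeff X i • innovation X (-i)))
      (inner ℝ (X k) (X 0)) :=
    (hasSum_wold ha hX hreg hν).mapL (innerSL ℝ (X k))
  have h2 : HasSum (fun i : ℕ => s * (woldSeq X ha i * woldSeq X ha (k + i))) (cov X k : ℂ) := by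
    rw [cov_eq_inner]
    refine (congrArg (HasSum · _) (funext fun i => ?_)).mpr (Complex.hasSum_ofReal.2 h1)
    rw [real_inner_smul_right, Complex.ofReal_mul, inner_innovation_eq ha hX hν, sub_neg_eq_add,
      woldSeq_natCast, ← hs]
    ring
  refine h2.unique (HasSum.mul_left s ?_)
  rw [conv_comm]
  have h3 := hasSum_conv (reflect (woldSeq X ha)) (woldSeq X ha) k
  rw [← Function.Injective.hasSum_iff (g := fun i : ℕ => -(i : ℤ))
    (neg_injective.comp Nat.cast_injective)] at h3
  · refine (congrArg (HasSum · _) (funext fun i => ?_)).mpr h3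
    simp [reflect_apply]
  · intro j hj
    rw [reflect_apply, woldSeq_of_neg ha, zero_mul]
    by_contra hcon
    exact hj ⟨(-j).toNat, by simp only [Int.toNat_of_nonneg (not_lt.1 hcon), neg_neg]⟩

/-- The transfer function of the Wold decomposition has no zero in the open unit disc. -/
theorem woldSeq_ne_zero_of_norm_lt_one (hX : JointlyStationary X X) (hν : innovation X 0 ≠ 0)
    {z : ℂ} (hz : ‖z‖ < 1) : ∑' k : ℕ, woldSeq X ha k * z ^ k ≠ 0 := by
  intro hzero
  set s : ℝ := inner ℝ (innovation X 0) (innovation X 0) with hs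
  have hs0 : s ≠ 0 := inner_self_ne_zero.2 hν
  -- With `Y = ∑ Re (z ^ k) • ν (-k)`, the inner product of `X (-n)` and `Y` is `s * Re (z ^ n * A
  -- z) = 0`. So `Y` is orthogonal to the past at time `0`, although its inner product with `ν 0` is
  -- `s`.
  have hsumY : Summable fun k : ℕ => (z ^ k).re • innovation X (-k) := by
    refine Summable.of_norm_bounded
      ((summable_geometric_of_lt_one (norm_nonneg z) hz).mul_right ‖innovation X 0‖) fun k => ?_
    rw [norm_smul, norm_innovation hX, ← norm_pow]
    gcongr
    exact Complex.abs_re_le_norm _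
  set Y := ∑' k : ℕ, (z ^ k).re • innovation X (-k) with hY
  have hinner : ∀ W : Lp ℝ 2 P,
      HasSum (fun k : ℕ => (z ^ k).re * inner ℝ W (innovation X (-k))) (inner ℝ W Y) := fun W => by
    simpa only [innerSL_apply_apply, real_inner_smul_right] using
      hsumY.hasSum.mapL (innerSL ℝ W)
  have hsumA : Summable fun k : ℕ => woldSeq X ha k * z ^ k := by
    refine Summable.of_norm_bounded (summable_geometric_of_lt_one (norm_nonneg z) hz
      |>.mul_left ‖woldSeq X ha‖) fun k => ?_
    rw [norm_mul, norm_pow]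
    gcongr
    exact lp.norm_apply_le_norm one_ne_zero _ _
  have hA : HasSum (fun k : ℕ => woldSeq X ha k * z ^ k) 0 := hzero ▸ hsumA.hasSum
  have horth : ∀ n : ℕ, inner ℝ (X (0 - n)) Y = 0 := fun n => by
    have h1 : HasSum (fun k : ℕ => z ^ k * woldSeq X ha (0 - n - -(k : ℤ))) 0 := by
      rw [← hasSum_nat_add_iff' n, Finset.sum_eq_zero, sub_zero]
      · have := hA.mul_left (z ^ n)
        rw [mul_zero] at this
        refine (congrArg (HasSum · _) (funext fun k => ?_)).mpr this
        rw [show (0 : ℤ) - n - -((k + n : ℕ) : ℤ) = k by push_cast; ring, pow_add]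
        ring
      · intro k hk
        rw [Finset.mem_range] at hk
        rw [woldSeq_of_neg ha (by omega), mul_zero]
    have h2 := Complex.hasSum_re (h1.mul_left (s : ℂ))
    rw [mul_zero, Complex.zero_re] at h2
    refine (hinner _).unique ((congrArg (HasSum · _) (funext fun k => ?_)).mpr h2)
    rw [mul_left_comm, ← inner_innovation_eq ha hX hν, Complex.re_mul_ofReal]
  have h0 : inner ℝ (innovation X 0) Y = 0 :=
    inner_eq_zero_of_mem_past (innovation_mem X 0) fun n _ => horth n
  have h1 : inner ℝ (innovation X 0) Y = s := by
    refine (hinner _).unique ?_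
    have := hasSum_single (f := fun k : ℕ =>
      (z ^ k).re * inner ℝ (innovation X 0) (innovation X (-k))) 0 (fun k hk => by
        rw [inner_innovation X (by omega), mul_zero])
    simpa [hs] using this
  exact hs0 (h1.symm.trans h0)

end Wold

/-! ### Spectral densities and invertibility -/

theorem spectralDensity_eq_fourierSum {x : EllOne} (hx : ∀ k, (cov X k : ℂ) = x k) (t : ℝ) :
    spectralDensity X t = fourierSum t x := by
  simp only [spectralDensity, fourierSum_apply, hx]

theorem summable_abs_cov {x : EllOne} (hx : ∀ k, (cov X k : ℂ) = x k) :
    Summable fun k => |cov X k| := by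
  refine (hasSum_norm x).summable.congr fun k => ?_
  rw [← hx, Complex.norm_real, Real.norm_eq_abs]

theorem memLp_spectralDensity {x : EllOne} (hx : ∀ k, (cov X k : ℂ) = x k) :
    MemLp (spectralDensity X) 2 (volume.restrict (Set.Ioc (-1 / 2 : ℝ) (1 / 2))) := by
  rw [funext (spectralDensity_eq_fourierSum hx)]
  exact MemLp.of_bound (continuous_fourierSum x).aestronglyMeasurable ‖x‖
    (Eventually.of_forall fun t => norm_fourierSum_le t x)

/-- The difference is bounded uniformly by the `ℓ¹` norm, and the frequency interval has measure
`1`. -/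
theorem eLpNorm_spectralDensity_sub_le {Y : ℤ → Lp ℝ 2 P} {x y : EllOne}
    (hx : ∀ k, (cov X k : ℂ) = x k) (hy : ∀ k, (cov Y k : ℂ) = y k) :
    eLpNorm (fun t => spectralDensity X t - spectralDensity Y t) 2
      (volume.restrict (Set.Ioc (-1 / 2 : ℝ) (1 / 2))) ≤ ENNReal.ofReal ‖x - y‖ := by
  refine (eLpNorm_le_of_ae_bound (C := ‖x - y‖) (Eventually.of_forall fun t => ?_)).trans ?_
  · rw [spectralDensity_eq_fourierSum hx, spectralDensity_eq_fourierSum hy, ← map_sub]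
    exact norm_fourierSum_le t _
  · rw [Measure.restrict_apply_univ, Real.volume_Ioc]
    norm_num

/-- If the spectral density is positive, then the Wold coefficients have a causal inverse. -/
theorem exists_woldSeq_inverse (hX : JointlyStationary X X) (hreg : IsRegular X)
    (hν : innovation X 0 ≠ 0) (ha : Summable fun k : ℕ => |woldCoeff X k|)
    (hpos : ∀ t ∈ Set.Ioc (-1 / 2 : ℝ) (1 / 2), 0 < spectralDensity X t) :
    ∃ b, trunc 0 b = b ∧ conv (woldSeq X ha) b = unit 0 := by
  refine exists_causal_inverse (trunc_woldSeq ha) fun z hz => ?_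
  rcases hz.lt_or_eq with hz | hz
  · exact woldSeq_ne_zero_of_norm_lt_one ha hX hν hz
  intro hzero
  -- The density at `t` factors as `s * A(t) * A(-t)`; frequency `-t` corresponds to the point `z`,
  -- so a zero there would annihilate it.
  set t : ℝ := Complex.arg z / (2 * Real.pi) with ht
  have hexp : Complex.exp (-2 * Real.pi * Complex.I * (-t : ℝ)) = z := by
    have h := Complex.norm_mul_exp_arg_mul_I z
    rw [hz, Complex.ofReal_one, one_mul] at h
    rw [← h]
    congr 1
    have hpi : (Real.pi : ℂ) ≠ 0 := Complex.ofReal_ne_zero.2 Real.pi_ne_zero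
    rw [ht]
    push_cast
    field_simp
  have hmem : t ∈ Set.Ioc (-1 / 2 : ℝ) (1 / 2) := by
    have h2 : 0 < 2 * Real.pi := by positivity
    rw [ht, Set.mem_Ioc, lt_div_iff₀ h2, div_le_iff₀ h2]
    constructor
    · linarith [Complex.neg_pi_lt_arg z]
    · linarith [Complex.arg_le_pi z]
  refine (hpos t hmem).ne' ?_
  have hcov : ∀ k, (cov X k : ℂ) = (((inner ℝ (innovation X 0) (innovation X 0) : ℝ) : ℂ) •
      conv (woldSeq X ha) (reflect (woldSeq X ha))) k := cov_eq_conv ha hX hreg hν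
  have hf : fourierSum (-t) (woldSeq X ha) = 0 := by
    have h := fourierSum_causal (-t) (trunc_woldSeq ha)
    rw [hexp] at h
    rw [← h.tsum_eq, hzero]
  rw [spectralDensity_eq_fourierSum hcov, map_smul, fourierSum_conv, fourierSum_reflect, hf, mul_zero,
    smul_zero]

/-! ### Convergence of the predictor filters -/

/-- The sequence of coefficients of a linear filter of order `p`. -/
def filterSeq (p : ℕ) (c : ℕ → ℝ) : EllOne :=
  -- The coefficient `c j` multiplies `X (n - 1 - j)`, whose lag is `j + 1`.
  ∑ j ∈ Finset.range p, (c j : ℂ) • unit (j + 1)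

theorem filterSeq_apply_of_nonpos (p : ℕ) (c : ℕ → ℝ) {k : ℤ} (hk : k ≤ 0) :
    filterSeq p c k = 0 := by
  rw [filterSeq, lp.coeFn_sum, Finset.sum_apply]
  refine Finset.sum_eq_zero fun j _ => ?_
  rw [lp.coeFn_smul, Pi.smul_apply, unit_apply, if_neg (by omega), smul_zero]

theorem filterSeq_apply_of_lt (p : ℕ) (c : ℕ → ℝ) {k : ℤ} (hk : p < k) :
    filterSeq p c k = 0 := by
  rw [filterSeq, lp.coeFn_sum, Finset.sum_apply]
  refine Finset.sum_eq_zero fun j hj => ?_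
  rw [Finset.mem_range] at hj
  rw [lp.coeFn_smul, Pi.smul_apply, unit_apply, if_neg (by omega), smul_zero]

theorem conv_filterSeq_apply (p : ℕ) (c : ℕ → ℝ) (x : EllOne) (k : ℤ) :
    conv (filterSeq p c) x k = ∑ j ∈ Finset.range p, c j * x (k - 1 - j) := by
  rw [filterSeq, map_sum, sum_apply, lp.coeFn_sum, Finset.sum_apply]
  refine Finset.sum_congr rfl fun j _ => ?_
  rw [map_smul, conv_unit, smul_apply, lp.coeFn_smul, Pi.smul_apply,
    shift_apply, smul_eq_mul, sub_sub, add_comm (1 : ℤ)]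

theorem conv_reflect_filterSeq_apply (p : ℕ) (c : ℕ → ℝ) (x : EllOne) (k : ℤ) :
    conv (reflect (filterSeq p c)) x k = ∑ j ∈ Finset.range p, c j * x (k + 1 + j) := by
  rw [filterSeq, map_sum, map_sum, sum_apply, lp.coeFn_sum, Finset.sum_apply]
  refine Finset.sum_congr rfl fun j _ => ?_
  rw [map_smul, map_smul, reflect_unit, conv_unit, smul_apply, lp.coeFn_smul,
    Pi.smul_apply, shift_apply, smul_eq_mul, sub_neg_eq_add, add_assoc, add_comm (1 : ℤ)]

/-- The covariance sequence of the predictor of order `p` with coefficients `c`. -/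
theorem cov_predictor_eq (hX : JointlyStationary X X) {x : EllOne}
    (hx : ∀ k, (cov X k : ℂ) = x k) {p : ℕ} {c : ℕ → ℝ}
    (hc : ∀ n, predictor X p n = ∑ j ∈ Finset.range p, c j • X (n - 1 - j)) (k : ℤ) :
    (cov (predictor X p) k : ℂ) =
      conv (filterSeq p c) (conv (reflect (filterSeq p c)) x) k := by
  rw [conv_filterSeq_apply, cov_eq_inner, hc, hc, sum_inner, Complex.ofReal_sum]
  refine Finset.sum_congr rfl fun i _ => ?_
  rw [real_inner_smul_left, inner_sum, Complex.ofReal_mul, Complex.ofReal_sum,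
    conv_reflect_filterSeq_apply]
  congr 1
  refine Finset.sum_congr rfl fun j _ => ?_
  rw [real_inner_smul_right, hX.inner_eq, ← cov_eq_inner, Complex.ofReal_mul, hx,
    show k - 1 - (i : ℤ) - (0 - 1 - j) = k - 1 - i + 1 + j by ring]

/-- The normal equations for the predictor of order `p`. -/
theorem normal_equations {x : EllOne}
    (hx : ∀ k, (cov X k : ℂ) = x k) {p : ℕ} {c : ℕ → ℝ}
    (hc : ∀ n, predictor X p n = ∑ j ∈ Finset.range p, c j • X (n - 1 - j))
    {k : ℤ} (h1 : 1 ≤ k) (hp : k ≤ p) : conv x (unit 0 - filterSeq p c) k = 0 := by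
  -- For `1 ≤ k ≤ p`, `X 0` is one of the `p` values preceding `X k`, so it is orthogonal to the
  -- prediction error at time `k`.
  have hmem : X 0 ∈ past X p (k - 1) := by
    have := mem_past X (p := p) (j := (k - 1).toNat) (by
      have : (k - 1).toNat < p := by omega
      exact_mod_cast this) (k - 1)
    rwa [Int.toNat_of_nonneg (by omega), sub_self] at this
  have h := inner_sub_predictor hmem
  rw [real_inner_comm, hc, inner_sub_left, sum_inner] at h
  rw [conv_comm, map_sub, sub_apply, unit_conv, lp.coeFn_sub, Pi.sub_apply,
    conv_filterSeq_apply, ← hx, cov_eq_inner, ← Complex.ofReal_zero, ← h, Complex.ofReal_sub,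
    Complex.ofReal_sum]
  congr 1
  refine Finset.sum_congr rfl fun j _ => ?_
  rw [real_inner_smul_left, ← cov_eq_inner, Complex.ofReal_mul, hx]

/-- The coefficients of the predictors of finite order converge in `ℓ¹`. -/
theorem tendsto_filterSeq (hX : JointlyStationary X X) (hreg : IsRegular X)
    (hν : innovation X 0 ≠ 0) (ha : Summable fun k : ℕ => |woldCoeff X k|)
    {b : EllOne} (hb : trunc 0 b = b) (hab : conv (woldSeq X ha) b = unit 0) {c : ℕ → ℕ → ℝ}
    (hc : ∀ p : ℕ, ∀ n, predictor X p n = ∑ j ∈ Finset.range p, c p j • X (n - 1 - j)) :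
    Tendsto (fun p => filterSeq p (c p)) atTop (𝓝 (unit 0 - b)) := by
  set a := woldSeq X ha with haa
  set s : ℂ := ((inner ℝ (innovation X 0) (innovation X 0) : ℝ) : ℂ) with hs
  have hs0 : s ≠ 0 := Complex.ofReal_ne_zero.2 (inner_self_ne_zero.2 hν)
  have hcov : ∀ k, (cov X k : ℂ) = (s • conv a (reflect a)) k := cov_eq_conv ha hX hreg hν
  -- By causality only `a 0 * b 0` contributes to `(a * b) 0 = 1`. This makes the error filter agree
  -- with `b` at index `0`.
  have hb0 : b 0 = 1 := by
    have h1 := hasSum_conv a b 0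
    have h2 : HasSum (fun k => a k * b (0 - k)) (a 0 * b (0 - 0)) := by
      refine hasSum_single 0 fun k hk => ?_
      rcases lt_or_gt_of_ne hk with h | h
      · rw [trunc_eq_self_iff.1 (trunc_woldSeq ha) k h, zero_mul]
      · rw [trunc_eq_self_iff.1 hb _ (by omega), mul_zero]
    have h3 := h1.unique h2
    rw [hab, unit_apply, if_pos rfl, haa, woldSeq_zero ha hX hν, one_mul, sub_zero] at h3
    exact h3.symm
  have hτ := tendsto_norm_trunc b
  have hbound : ∀ᶠ p : ℕ in atTop, ‖filterSeq p (c p) - (unit 0 - b)‖ ≤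
      2 * ‖a‖ ^ 2 * ‖b‖ ^ 2 * ‖trunc (p + 1) b‖ := by
    have hsmall : ∀ᶠ p : ℕ in atTop, ‖a‖ ^ 2 * ‖b‖ * ‖trunc (p + 1) b‖ < 1 / 2 := by
      have := hτ.const_mul (‖a‖ ^ 2 * ‖b‖)
      rw [mul_zero] at this
      exact this.eventually_lt_const (by norm_num)
    filter_upwards [hsmall] with p hp
    rw [← norm_neg, show -(filterSeq p (c p) - (unit 0 - b)) = unit 0 - filterSeq p (c p) - b by
      abel]
    refine norm_sub_le_of_normal_equations (trunc_woldSeq ha) hb hab ?_ ?_ ?_ hp.le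
    · rw [trunc_eq_self_iff]
      intro j hj
      rw [lp.coeFn_sub, lp.coeFn_sub, Pi.sub_apply, Pi.sub_apply,
        filterSeq_apply_of_nonpos _ _ (by omega), unit_apply]
      split_ifs with h
      · rw [h, hb0]; ring
      · rw [trunc_eq_self_iff.1 hb j (by omega)]; ring
    · rw [trunc_eq_zero_iff]
      intro j hj
      rw [lp.coeFn_sub, Pi.sub_apply, filterSeq_apply_of_lt _ _ (by omega), unit_apply,
        if_neg (by omega), sub_zero]
    · intro j h1 h2
      have h := normal_equations hcov (hc p) h1 h2
      rw [map_smul, smul_apply, lp.coeFn_smul, Pi.smul_apply, smul_eq_mul] at h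
      exact (mul_eq_zero.1 h).resolve_left hs0
  rw [tendsto_iff_norm_sub_tendsto_zero]
  refine squeeze_zero' (Eventually.of_forall fun _ => norm_nonneg _) hbound ?_
  simpa using hτ.const_mul (2 * ‖a‖ ^ 2 * ‖b‖ ^ 2)

end WSS

end

/-! ### Convergence of covariances and spectral densities -/

theorem mainTheorem3 {Ω : Type*} [MeasurableSpace Ω] (P : Measure Ω) [IsProbabilityMeasure P]
    (X : ℤ → Lp ℝ 2 P) (hX : WSS.IsWSS X) (hreg : WSS.IsRegular X)
    (hpos : ∀ t ∈ Set.Ioc (-1 / 2 : ℝ) (1 / 2), 0 < WSS.spectralDensity X t)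
    (ha : Summable fun k : ℕ => |WSS.woldCoeff X k|) :
    -- the predictors of all orders `p ≤ ∞` are wide-sense stationary with covariances in `ℓ¹`
    -- and spectral density in `L²`
    (∀ p : ℕ∞, WSS.IsWSS (WSS.predictor X p) ∧
      (Summable fun k : ℤ => |WSS.cov (WSS.predictor X p) k|) ∧
      MemLp (WSS.spectralDensity (WSS.predictor X p)) 2
        (volume.restrict (Set.Ioc (-1 / 2 : ℝ) (1 / 2)))) ∧
    Tendsto (fun p : ℕ => ∑' k : ℤ,
        |WSS.cov (WSS.predictor X (p : ℕ∞)) k - WSS.cov (WSS.predictor X ⊤) k|)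
      atTop (𝓝 0) ∧
    Tendsto (fun p : ℕ => eLpNorm
        (fun t => WSS.spectralDensity (WSS.predictor X (p : ℕ∞)) t
          - WSS.spectralDensity (WSS.predictor X ⊤) t) 2
        (volume.restrict (Set.Ioc (-1 / 2 : ℝ) (1 / 2))))
      atTop (𝓝 0) := by
  have hst := hX.jointlyStationary
  -- Otherwise every covariance, and hence the density at frequency `0`, would vanish.
  have hX0 : X 0 ≠ 0 := by
    intro h0
    refine (hpos 0 (by norm_num)).ne' ?_
    simp [WSS.spectralDensity, WSS.cov_eq_inner, h0]
  have hν := WSS.innovation_ne_zero hst hreg hX0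
  obtain ⟨b, hb, hab⟩ := WSS.exists_woldSeq_inverse hst hreg hν ha hpos
  choose c hc using WSS.exists_predictor_eq_sum hst
  have hlim := WSS.tendsto_filterSeq hst hreg hν ha hb hab hc
  obtain ⟨x, hx⟩ : ∃ x : EllOne, ∀ k, (WSS.cov X k : ℂ) = x k :=
    ⟨((inner ℝ (WSS.innovation X 0) (WSS.innovation X 0) : ℝ) : ℂ) •
      EllOne.conv (WSS.woldSeq X ha) (EllOne.reflect (WSS.woldSeq X ha)),
      WSS.cov_eq_conv ha hst hreg hν⟩
  -- the covariance sequences of the predictors, as elements of `ℓ¹(ℤ)`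
  let F : EllOne → EllOne := fun γ => EllOne.conv γ (EllOne.conv (EllOne.reflect γ) x)
  have hF : Continuous F := by fun_prop
  let θ : ℕ → EllOne := fun p => F (WSS.filterSeq p (c p))
  have hθ : ∀ p : ℕ, ∀ k, (WSS.cov (WSS.predictor X p) k : ℂ) = θ p k := fun p k =>
    WSS.cov_predictor_eq hst hx (hc p) k
  obtain ⟨η, hη⟩ : ∃ η, Tendsto θ atTop (𝓝 η) := ⟨_, (hF.tendsto _).comp hlim⟩
  -- The `ℓ¹` limit is identified coordinatewise, by convergence of the predictors in `L²(P)`.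
  have hηcov : ∀ k, (WSS.cov (WSS.predictor X ⊤) k : ℂ) = η k := fun k => by
    have h1 : Tendsto (fun p : ℕ => (WSS.cov (WSS.predictor X p) k : ℂ)) atTop
        (𝓝 (WSS.cov (WSS.predictor X ⊤) k : ℂ)) := by
      simp only [WSS.cov_eq_inner]
      exact (Complex.continuous_ofReal.tendsto _).comp
        ((WSS.tendsto_predictor X k).inner (WSS.tendsto_predictor X 0))
    have h2 : Tendsto (fun p : ℕ => θ p k) atTop (𝓝 (η k)) :=
      ((lp.evalCLM ℂ (fun _ : ℤ => ℂ) 1 k).continuous.tendsto η).comp hη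
    simp only [hθ] at h1
    exact tendsto_nhds_unique h1 h2
  have hnorm : Tendsto (fun p => ‖θ p - η‖) atTop (𝓝 0) :=
    tendsto_iff_norm_sub_tendsto_zero.1 hη
  refine ⟨fun p => ⟨hX.predictor p, ?_⟩, ?_, ?_⟩
  · obtain ⟨y, hy⟩ : ∃ y : EllOne, ∀ k, (WSS.cov (WSS.predictor X p) k : ℂ) = y k := by
      induction p using ENat.recTopCoe with
      | top => exact ⟨η, hηcov⟩
      | coe p => exact ⟨θ p, hθ p⟩
    exact ⟨WSS.summable_abs_cov hy, WSS.memLp_spectralDensity hy⟩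
  · refine hnorm.congr fun p => ?_
    rw [← (EllOne.hasSum_norm _).tsum_eq]
    refine tsum_congr fun k => ?_
    rw [lp.coeFn_sub, Pi.sub_apply, ← hθ, ← hηcov, ← Complex.ofReal_sub, Complex.norm_real,
      Real.norm_eq_abs]
  · refine tendsto_of_tendsto_of_tendsto_of_le_of_le tendsto_const_nhds ?_ (fun _ => zero_le)
      fun p => WSS.eLpNorm_spectralDensity_sub_le (hθ p) hηcov
    simpa using ENNReal.tendsto_ofReal hnorm
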